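/- Let $G=(V,E,W)$ be a finite graph with nonnegative edge weights. For $t\ge 0$ let $\mathcal G^*_t$ be the graph with vertex set $V$ and edge set $\{e\in E: W(e)\le t\}$, and let $N_t(v)$ be the number of vertices in the connected component of $v$ in $\mathcal G^*_t$. For an integer $k\ge 1$ put $\tau_k(v)=\inf\{t\ge 0: N_t(v)\ge k\}$ for $v\in V$ (with $\inf\emptyset=\infty$) and $\tau_k((u,v))=\max(\tau_k(u),\tau_k(v),W((u,v)))$ for $(u,v)\in E$. The $k$-cluster filtration of $G$ at level $t$ is the subgraph $\mathcal G^{(k)}_t$ consisting of all vertices and edges $x$ with $\tau_k(x)\le t$. For $n\ge 1$ and $p\in[0,1]$, let $G^{(k)}(n,p)$ be the $k$-cluster filtration at level $p$ of the complete graph on $n$ vertices whose edge weights are independent and uniformly distributed on $[0,1]$ (so that $\mathcal G^*_p$ is the random graph $G(n,p)$). A graph is called connected if it is nonempty and any two of its vertices are joined by a path. **Theorem.** Fix an integer $k\ge 1$, and let $w(n)$ be a real sequence with $w(n)\to\infty$ and $w(n)=o(\log\log n)$. Let $p=p(n)$ and $\Lambda=np$. Then $$\lim_{n\to\infty}\mathbb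 P\big(G^{(k)}(n,p)\text{ is connected}\big)=\begin{cases}1 & \text{if } \Lambda=\frac1k\big(\log n+(k-1)\log\log n\big)+w(n) \text{ for all sufficiently large } n,\\[2pt] 0 & \text{if } \Lambda=\frac1k\big(\log n+(k-1)\log\log n\big)-w(n) \text{ for all sufficiently large } n.\end{cases}$$ -/

import Mathlib

open Filter Topology MeasureTheory Asymptotics

noncomputable section

namespace KCluster

variable {V : Type*} {G : SimpleGraph V}

/-- The standard sublevel filtration `𝒢*_t` (for `t ≥ 0`) of a weighted graph `(V, E, W)`:
all vertices are present, and an edge `e` of `G` is present once `W e ≤ t`. -/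
def standardFiltration (W : G.edgeSet → ℝ) (t : ℝ) : SimpleGraph V where
  Adj u v := ∃ h : G.Adj u v, W ⟨s(u, v), h⟩ ≤ t
  symm := ⟨by
    rintro u v ⟨h, hW⟩
    refine ⟨h.symm, ?_⟩
    have e : (⟨s(v, u), h.symm⟩ : G.edgeSet) = ⟨s(u, v), h⟩ := Subtype.ext Sym2.eq_swap
    rw [e]
    exact hW⟩
  loopless := ⟨fun u ⟨h, _⟩ => G.irrefl h⟩

/-- `N_t(v)`: the number of vertices of the connected component of `v` in `𝒢*_t`. -/
def componentSize (W : G.edgeSet → ℝ) (t : ℝ) (v : V) : ℕ∞ :=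
  ((standardFiltration W t).connectedComponentMk v).supp.encard

/-- The filtration value of a vertex, `τ_k(v) = inf {t ≥ 0 : N_t(v) ≥ k}`.
It is `⊤` if the component of `v` never reaches size `k`. -/
def vertexValue (k : ℕ) (W : G.edgeSet → ℝ) (v : V) : EReal :=
  sInf {s : EReal | ∃ t : ℝ, 0 ≤ t ∧ (k : ℕ∞) ≤ componentSize W t v ∧ s = (t : EReal)}

/-- The filtration value of an edge, `τ_k((u,v)) = max (τ_k(u), τ_k(v), W((u,v)))`. -/
def edgeValue (k : ℕ) (W : G.edgeSet → ℝ) {u v : V} (h : G.Adj u v) : EReal :=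
  max (max (vertexValue k W u) (vertexValue k W v)) ((W ⟨s(u, v), h⟩ : ℝ) : EReal)

/-- The `k`-cluster filtration `𝒢^{(k)}_t` of a weighted graph: the subgraph of `G` formed by the
vertices and edges whose filtration value `τ_k` is at most `t`. -/
def clusterFiltration (k : ℕ) (W : G.edgeSet → ℝ) (t : ℝ) : G.Subgraph where
  verts := {v | vertexValue k W v ≤ (t : EReal)}
  Adj u v := ∃ h : G.Adj u v, edgeValue k W h ≤ (t : EReal)
  adj_sub := fun ⟨h, _⟩ => h
  edge_vert := fun ⟨_, hv⟩ => le_trans (le_trans (le_max_left _ _) (le_max_left _ _)) hv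
  symm := ⟨by
    rintro u v ⟨h, hv⟩
    refine ⟨h.symm, ?_⟩
    have e : (⟨s(v, u), h.symm⟩ : G.edgeSet) = ⟨s(u, v), h⟩ := Subtype.ext Sym2.eq_swap
    unfold edgeValue at hv ⊢
    rw [e, max_comm (vertexValue k W v)]
    exact hv⟩

/-- The joint law of independent edge weights, uniform on `[0,1]`, on the complete graph with
`n` vertices. Keeping the edges of weight at most `p` gives the random graph `G(n,p)`. -/
def uniformWeights (n : ℕ) : Measure ((⊤ : SimpleGraph (Fin n)).edgeSet → ℝ) :=
  Measure.pi fun _ => volume.restrict (Set.Icc (0 : ℝ) 1)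

/-- The probability that `G^{(k)}(n,p)`, the `k`-cluster filtration of the uniformly weighted
complete graph at level `p`, is connected (in particular nonempty). -/
def probConnected (k n : ℕ) (p : ℝ) : ℝ :=
  (uniformWeights n).real {W | (clusterFiltration k W p).Connected}

end KCluster

end

noncomputable section

namespace KCluster

/-! ### Components, cut-off sets and connectedness of the filtration -/

section Deterministic

variable {V : Type*} {G : SimpleGraph V}

/-! On a finite graph the level-`p` subgraph consists exactly of the components of `𝒢*_p` with at
least `k` vertices. It is therefore connected iff there is exactly one such component
(`clusterFiltration_connected_iff`). With `l = np`, the expected number of components of size `k` in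
`G(n,p)` has order `Q = n l^(k-1) e^(-kl)`, called `expectedOrder`. Writing `l = (log n + (k-1) log
log n)/k + u`, one finds `Q = (l / log n)^(k-1) e^(-ku)` with `l / log n → 1/k`, so `Q → 0` for `u =
w` and `Q → ∞` for `u = -w`.

Above the threshold a first moment bound suffices. If the filtration is not connected, either some
component has between `k` and `n/2` vertices, or all components have fewer than `k` vertices and
some union of them has between `n/4` and `n/2` (`exists_of_not_connected`). The second case has
probability at most `2^n e^(-pn²/8)`. In the first, the union bound runs over vertex sets and
spanning trees. Sizes below `8k` cost a constant times `Q`, since each extra vertex brings a factor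
of order `l e^(-l)`. Larger sizes decay geometrically, and their total is again bounded through `Q`
(`one_sub_probConnected_le'`).

Below the threshold a second moment bound yields two components of size exactly `k`, which
disconnects the filtration. Only components containing one prescribed spanning star are counted:
these events have exact product probabilities, and restricting to them loses only a constant factor
in the mean. Two such events are nearly independent, with correlation factor at most `(1-p)^(-k²) →
1` (`measureReal_starEvent_inter_le`), so Chebyshev's inequality applies (`probConnected_le'`). -/

theorem standardFiltration_mono (W : G.edgeSet → ℝ) {s t : ℝ}
    (h : ∀ e, W e ≤ s → W e ≤ t) : standardFiltration W s ≤ standardFiltration W t := by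
  rintro u v ⟨huv, hW⟩
  exact ⟨huv, h _ hW⟩

theorem componentSize_mono (W : G.edgeSet → ℝ) {s t : ℝ}
    (h : ∀ e, W e ≤ s → W e ≤ t) (v : V) : componentSize W s v ≤ componentSize W t v := by
  refine Set.encard_le_encard fun u hu => ?_
  rw [SimpleGraph.ConnectedComponent.mem_supp_iff, SimpleGraph.ConnectedComponent.eq] at hu ⊢
  exact hu.mono (standardFiltration_mono W h)

theorem componentSize_congr (W : G.edgeSet → ℝ) {t : ℝ} {u v : V}
    (h : (standardFiltration W t).Reachable u v) :
    componentSize W t u = componentSize W t v := by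
  unfold componentSize
  rw [SimpleGraph.ConnectedComponent.eq.2 h]

/-- The infimum may be tested at `p` itself: there are finitely many weights, so none lies in `(p,
q]` for `q` slightly above `p`, and the graphs at levels `p` and `q` coincide. -/
theorem vertexValue_le_iff [Finite V] (k : ℕ) (W : G.edgeSet → ℝ) {p : ℝ} (hp : 0 ≤ p) (v : V) :
    vertexValue k W v ≤ (p : EReal) ↔ (k : ℕ∞) ≤ componentSize W p v := by
  constructor
  · intro h
    have hev : ∀ᶠ q in 𝓝[>] p, ∀ e, W e ≤ p ∨ q < W e := by
      refine eventually_all.2 fun e => ?_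
      by_cases he : W e ≤ p
      · exact Eventually.of_forall fun _ => Or.inl he
      · filter_upwards [mem_nhdsWithin_of_mem_nhds (Iio_mem_nhds (not_le.1 he))] with q hq
        exact Or.inr hq
    obtain ⟨q, hq, hpq⟩ := (hev.and self_mem_nhdsWithin).exists
    have hlt : vertexValue k W v < (q : EReal) := h.trans_lt (EReal.coe_lt_coe_iff.2 hpq)
    obtain ⟨s, ⟨t, -, hk, rfl⟩, hs⟩ := sInf_lt_iff.1 hlt
    rw [EReal.coe_lt_coe_iff] at hs
    refine hk.trans (componentSize_mono W (fun e he => ?_) v)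
    rcases hq e with h1 | h1
    · exact h1
    · linarith
  · intro h
    exact sInf_le ⟨p, hp, h, rfl⟩

theorem clusterFiltration_adj_iff [Finite V] (k : ℕ) (W : G.edgeSet → ℝ) {p : ℝ} (hp : 0 ≤ p)
    {u v : V} : (clusterFiltration k W p).Adj u v ↔
      (standardFiltration W p).Adj u v ∧ (k : ℕ∞) ≤ componentSize W p u := by
  constructor
  · rintro ⟨h, he⟩
    simp only [edgeValue, max_le_iff, EReal.coe_le_coe_iff, vertexValue_le_iff k W hp] at he
    exact ⟨⟨h, he.2⟩, he.1.1⟩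
  · rintro ⟨⟨h, hW⟩, hu⟩
    refine ⟨h, ?_⟩
    simp only [edgeValue, max_le_iff, EReal.coe_le_coe_iff, vertexValue_le_iff k W hp]
    refine ⟨⟨hu, ?_⟩, hW⟩
    rwa [← componentSize_congr W (SimpleGraph.Adj.reachable ⟨h, hW⟩)]

/-- Component size is constant along a path of `𝒢*_p`, so a path starting at a vertex of the
filtration never leaves it. -/
theorem clusterFiltration_connected_iff [Finite V] (k : ℕ) (W : G.edgeSet → ℝ) {p : ℝ}
    (hp : 0 ≤ p) : (clusterFiltration k W p).Connected ↔
      (∃ v, (k : ℕ∞) ≤ componentSize W p v) ∧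
        ∀ u v, (k : ℕ∞) ≤ componentSize W p u → (k : ℕ∞) ≤ componentSize W p v →
          (standardFiltration W p).Reachable u v := by
  rw [SimpleGraph.Subgraph.connected_iff, and_comm]
  refine and_congr ?_ ?_
  · exact exists_congr fun v => vertexValue_le_iff k W hp v
  · constructor
    · intro h u v hu hv
      have hr := h.coe ⟨u, (vertexValue_le_iff k W hp u).2 hu⟩
        ⟨v, (vertexValue_le_iff k W hp v).2 hv⟩
      let f : (clusterFiltration k W p).coe →g standardFiltration W p :=
        ⟨Subtype.val, fun {a b} hab => ((clusterFiltration_adj_iff k W hp).1 hab).1⟩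
      exact hr.map f
    · refine fun h => ⟨?_⟩
      rintro ⟨u, hu⟩ ⟨v, hv⟩
      obtain ⟨w⟩ := h u v ((vertexValue_le_iff k W hp u).1 hu) ((vertexValue_le_iff k W hp v).1 hv)
      induction w with
      | nil => exact SimpleGraph.Reachable.refl _
      | @cons a b c hab w ih =>
        have ha := (vertexValue_le_iff k W hp a).1 hu
        have hb : vertexValue k W b ≤ p := by
          rwa [vertexValue_le_iff k W hp, ← componentSize_congr W hab.reachable]
        have hadj : (clusterFiltration k W p).coe.Adj ⟨a, hu⟩ ⟨b, hb⟩ :=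
          (clusterFiltration_adj_iff k W hp).2 ⟨hab, ha⟩
        exact hadj.reachable.trans (ih hb hv)

/-- No edge of `H` leaves the vertex set `S`. -/
def IsCutOff (H : SimpleGraph V) (S : Finset V) : Prop :=
  ∀ x ∈ S, ∀ y ∉ S, ¬ H.Adj x y

/-- `S` is the vertex set of a connected component of `H`. -/
def IsComponent (H : SimpleGraph V) (S : Finset V) : Prop :=
  ∃ v ∈ S, ∀ x, x ∈ S ↔ H.Reachable v x

theorem IsComponent.isCutOff {H : SimpleGraph V} {S : Finset V} (h : IsComponent H S) :
    IsCutOff H S := by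
  obtain ⟨v, -, hS⟩ := h
  intro x hx y hy hxy
  exact hy ((hS y).2 (((hS x).1 hx).trans hxy.reachable))

/-- The connected component of a vertex, as a finset. -/
def componentFinset [Fintype V] (H : SimpleGraph V) (v : V) : Finset V :=
  (Set.toFinite (H.connectedComponentMk v).supp).toFinset

theorem mem_componentFinset [Fintype V] {H : SimpleGraph V} {v x : V} :
    x ∈ componentFinset H v ↔ H.Reachable v x := by
  rw [componentFinset, Set.Finite.mem_toFinset, SimpleGraph.ConnectedComponent.mem_supp_iff,
    SimpleGraph.ConnectedComponent.eq]
  exact SimpleGraph.reachable_comm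

theorem isComponent_componentFinset [Fintype V] (H : SimpleGraph V) (v : V) :
    IsComponent H (componentFinset H v) :=
  ⟨v, mem_componentFinset.2 (SimpleGraph.Reachable.refl _), fun _ => mem_componentFinset⟩

theorem le_componentSize_iff [Fintype V] (k : ℕ) (W : G.edgeSet → ℝ) (p : ℝ) (v : V) :
    (k : ℕ∞) ≤ componentSize W p v ↔ k ≤ (componentFinset (standardFiltration W p) v).card := by
  rw [componentSize, componentFinset, Set.Finite.encard_eq_coe_toFinset_card (Set.toFinite _),
    Nat.cast_le]

/-- If all components are small then a union of components has about half of the vertices. -/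
theorem exists_balanced_isCutOff [Fintype V] (H : SimpleGraph V) {k : ℕ}
    (hk : 4 * k ≤ Fintype.card V)
    (hsmall : ∀ v, (componentFinset H v).card < k) :
    ∃ S : Finset V, IsCutOff H S ∧ Fintype.card V ≤ 4 * S.card ∧
      2 * S.card ≤ Fintype.card V := by
  classical
  -- Take a largest cut-off set with at most half of the vertices. If it had fewer than a quarter,
  -- adding one more component, of size less than `k ≤ |V|/4`, would contradict maximality.
  obtain ⟨S, hS, hmax⟩ := Finset.exists_max_image
    (Finset.univ.filter fun S : Finset V => IsCutOff H S ∧ 2 * S.card ≤ Fintype.card V)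
    Finset.card ⟨∅, Finset.mem_filter.2 ⟨Finset.mem_univ _, by simp [IsCutOff]⟩⟩
  simp only [Finset.mem_filter, Finset.mem_univ, true_and] at hS hmax
  refine ⟨S, hS.1, ?_, hS.2⟩
  rcases Nat.eq_zero_or_pos (Fintype.card V) with h0 | hpos
  · omega
  obtain ⟨v, hv⟩ : ∃ v, v ∉ S := by
    by_contra! hall
    have : S.card = Fintype.card V := by
      rw [Finset.eq_univ_iff_forall.2 hall, Finset.card_univ]
    omega
  have hv' : v ∈ componentFinset H v := mem_componentFinset.2 (SimpleGraph.Reachable.refl _)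
  by_contra hlt
  have hle : (S ∪ componentFinset H v).card ≤ S.card + (componentFinset H v).card :=
    Finset.card_union_le _ _
  have hc := hsmall v
  have hcut : IsCutOff H (S ∪ componentFinset H v) := by
    intro x hx y hy hxy
    rw [Finset.mem_union, not_or] at hy
    rcases Finset.mem_union.1 hx with h | h
    · exact hS.1 x h y hy.1 hxy
    · exact (isComponent_componentFinset H v).isCutOff x h y hy.2 hxy
  have h1 := hmax _ ⟨hcut, by omega⟩
  have h2 : S.card < (S ∪ componentFinset H v).card :=
    Finset.card_lt_card (Finset.ssubset_iff_subset_ne.2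
      ⟨Finset.subset_union_left, fun h => hv (h ▸ Finset.mem_union_right _ hv')⟩)
  omega

theorem exists_of_not_connected [Fintype V] {k : ℕ} (W : G.edgeSet → ℝ) {p : ℝ} (hp : 0 ≤ p)
    (hk : 4 * k ≤ Fintype.card V) (h : ¬ (clusterFiltration k W p).Connected) :
    (∃ S : Finset V, IsComponent (standardFiltration W p) S ∧ k ≤ S.card ∧
      2 * S.card ≤ Fintype.card V) ∨
    ∃ S : Finset V, IsCutOff (standardFiltration W p) S ∧ Fintype.card V ≤ 4 * S.card ∧
      2 * S.card ≤ Fintype.card V := by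
  classical
  rw [clusterFiltration_connected_iff k W hp, not_and_or] at h
  simp only [le_componentSize_iff] at h
  rcases h with h | h
  · push Not at h
    exact Or.inr (exists_balanced_isCutOff _ hk h)
  · push Not at h
    obtain ⟨u, v, hu, hv, huv⟩ := h
    set H := standardFiltration W p
    have hdisj : Disjoint (componentFinset H u) (componentFinset H v) := by
      rw [Finset.disjoint_left]
      intro x hx hx'
      rw [mem_componentFinset] at hx hx'
      exact huv (hx.trans hx'.symm)
    have hcard := Finset.card_le_univ (componentFinset H u ∪ componentFinset H v)
    rw [Finset.card_union_of_disjoint hdisj] at hcard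
    left
    rcases le_total (componentFinset H u).card (componentFinset H v).card with hle | hle
    · exact ⟨_, isComponent_componentFinset H u, hu, by omega⟩
    · exact ⟨_, isComponent_componentFinset H v, hv, by omega⟩

theorem not_connected_of_two_components [Fintype V] {k : ℕ} (W : G.edgeSet → ℝ) {p : ℝ}
    (hp : 0 ≤ p) {S T : Finset V} (hST : S ≠ T) (hS : IsComponent (standardFiltration W p) S)
    (hT : IsComponent (standardFiltration W p) T) (hkS : k ≤ S.card) (hkT : k ≤ T.card) :
    ¬ (clusterFiltration k W p).Connected := by
  rw [clusterFiltration_connected_iff k W hp]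
  rintro ⟨-, h⟩
  simp only [le_componentSize_iff] at h
  obtain ⟨u, hu, hSu⟩ := hS
  obtain ⟨v, hv, hTv⟩ := hT
  have eS : componentFinset (standardFiltration W p) u = S := by
    ext x; rw [mem_componentFinset, hSu]
  have eT : componentFinset (standardFiltration W p) v = T := by
    ext x; rw [mem_componentFinset, hTv]
  have huv := h u v (by rwa [eS]) (by rwa [eT])
  apply hST
  ext x
  rw [hSu, hTv]
  exact ⟨fun hx => huv.symm.trans hx, fun hx => huv.trans hx⟩

/-- Every vertex of a component other than a root has a neighbour closer to the root. -/
theorem exists_adj_dist_lt {H : SimpleGraph V} {v x : V} (h : H.Reachable v x) (hne : x ≠ v) :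
    ∃ y, H.Adj x y ∧ H.Reachable v y ∧ H.dist v y < H.dist v x := by
  obtain ⟨w, hw⟩ := h.symm.exists_walk_length_eq_dist
  cases w with
  | nil => exact absurd rfl hne
  | @cons _ y _ hxy w =>
    refine ⟨y, hxy, w.reachable.symm, ?_⟩
    rw [SimpleGraph.dist_comm (u := v) (v := y), SimpleGraph.dist_comm (u := v) (v := x), ← hw,
      SimpleGraph.Walk.length_cons]
    exact Nat.lt_succ_of_le (SimpleGraph.dist_le w)

/-- The edges `s(x, f x)` of the functional graph of `f` on `S`. -/
def parentEdges [DecidableEq V] (S : Finset V) (f : V → V) : Finset (Sym2 V) :=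
  (S.filter fun x => f x ≠ x).image fun x => s(x, f x)

/-- A component has a spanning tree, encoded by a parent map that fixes the root. -/
theorem IsComponent.exists_parent [DecidableEq V] {H : SimpleGraph V} {S : Finset V}
    (hS : IsComponent H S) :
    ∃ f : V → V, (∀ x ∈ S, f x ∈ S) ∧ (∀ x ∉ S, f x = x) ∧
      (parentEdges S f).card = S.card - 1 ∧ ∀ e ∈ parentEdges S f, e ∈ H.edgeSet := by
  obtain ⟨v, hv, hS⟩ := hS
  have hex : ∀ x, ∃ y, (x ∈ S → x ≠ v →
      H.Adj x y ∧ H.Reachable v y ∧ H.dist v y < H.dist v x) ∧ (x ∉ S ∨ x = v → y = x) := by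
    intro x
    by_cases hx : x ∈ S ∧ x ≠ v
    · obtain ⟨y, hy⟩ := exists_adj_dist_lt ((hS x).1 hx.1) hx.2
      exact ⟨y, fun _ _ => hy, fun h => by tauto⟩
    · exact ⟨x, fun h1 h2 => absurd ⟨h1, h2⟩ hx, fun _ => rfl⟩
  choose f hf hf' using hex
  have hfilter : (S.filter fun x => f x ≠ x) = S.erase v := by
    ext x
    simp only [Finset.mem_filter, Finset.mem_erase]
    constructor
    · rintro ⟨hx, hne⟩
      exact ⟨fun h => hne (hf' x (Or.inr h)), hx⟩
    · rintro ⟨hne, hx⟩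
      exact ⟨hx, (hf x hx hne).1.ne'⟩
  refine ⟨f, fun x hx => ?_, fun x hx => hf' x (Or.inl hx), ?_, ?_⟩
  · by_cases hxv : x = v
    · rwa [hf' x (Or.inr hxv)]
    · exact (hS _).2 (hf x hx hxv).2.1
  · rw [parentEdges, hfilter, Finset.card_image_of_injOn, Finset.card_erase_of_mem hv]
    -- The map `x ↦ s(x, f x)` is injective away from the root: two vertices that are each other's
    -- parent would each be strictly closer to the root than the other.
    intro x hx y hy hxy
    simp only [Finset.coe_erase, Set.mem_sdiff, Finset.mem_coe, Set.mem_singleton_iff] at hx hy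
    rcases Sym2.eq_iff.1 hxy with h | h
    · exact h.1
    · have h1 := (hf x hx.1 hx.2).2.2
      have h2 := (hf y hy.1 hy.2).2.2
      rw [h.2] at h1
      rw [← h.1] at h2
      omega
  · intro e he
    rw [parentEdges, hfilter, Finset.mem_image] at he
    obtain ⟨x, hx, rfl⟩ := he
    rw [Finset.mem_erase] at hx
    exact (hf x hx.2 hx.1).1

end Deterministic

/-! ### Edge events and the first moment bound -/

section Probability

variable {n : ℕ}

instance isProbabilityMeasure_uniform :
    IsProbabilityMeasure (volume.restrict (Set.Icc (0 : ℝ) 1)) :=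
  ⟨by simp⟩

instance isProbabilityMeasure_uniformWeights (n : ℕ) : IsProbabilityMeasure (uniformWeights n) := by
  unfold uniformWeights
  infer_instance

theorem uniform_Iic {p : ℝ} (h1 : p ≤ 1) :
    volume.restrict (Set.Icc (0 : ℝ) 1) (Set.Iic p) = ENNReal.ofReal p := by
  rw [Measure.restrict_apply measurableSet_Iic]
  have : Set.Iic p ∩ Set.Icc (0 : ℝ) 1 = Set.Icc 0 p := by
    ext x
    simp only [Set.mem_inter_iff, Set.mem_Iic, Set.mem_Icc]
    exact ⟨fun h => ⟨h.2.1, h.1⟩, fun h => ⟨h.2, h.1, h.2.trans h1⟩⟩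
  rw [this, Real.volume_Icc, sub_zero]

theorem uniform_Ioi {p : ℝ} (h0 : 0 ≤ p) :
    volume.restrict (Set.Icc (0 : ℝ) 1) (Set.Ioi p) = ENNReal.ofReal (1 - p) := by
  rw [Measure.restrict_apply measurableSet_Ioi]
  have : Set.Ioi p ∩ Set.Icc (0 : ℝ) 1 = Set.Ioc p 1 := by
    ext x
    simp only [Set.mem_inter_iff, Set.mem_Ioi, Set.mem_Icc, Set.mem_Ioc]
    constructor
    · rintro ⟨a, b, c⟩
      exact ⟨a, c⟩
    · rintro ⟨a, b⟩
      exact ⟨a, by linarith, b⟩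
  rw [this, Real.volume_Ioc]

/-- The event that all edges in `T` are present and all edges in `U` are absent at level `p`. -/
def edgeEvent (T U : Finset (Sym2 (Fin n))) (p : ℝ) :
    Set ((⊤ : SimpleGraph (Fin n)).edgeSet → ℝ) :=
  {W | (∀ e, e.1 ∈ T → W e ≤ p) ∧ ∀ e, e.1 ∈ U → p < W e}

theorem measurableSet_edgeEvent (T U : Finset (Sym2 (Fin n))) (p : ℝ) :
    MeasurableSet (edgeEvent T U p) := by
  unfold edgeEvent
  measurability

theorem prod_edgeSet_ite (T : Finset (Sym2 (Fin n)))
    (hT : ∀ e ∈ T, e ∈ (⊤ : SimpleGraph (Fin n)).edgeSet) (a : ℝ)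
    [Fintype (⊤ : SimpleGraph (Fin n)).edgeSet] :
    ∏ e : (⊤ : SimpleGraph (Fin n)).edgeSet, (if e.1 ∈ T then a else 1) = a ^ T.card := by
  classical
  rw [Finset.prod_ite, Finset.prod_const_one, mul_one, Finset.prod_const]
  congr 1
  refine Finset.card_bij (fun e _ => e.1) (fun e he => (Finset.mem_filter.1 he).2)
    (fun e _ e' _ h => Subtype.ext h)
    (fun e he => ⟨⟨e, hT e he⟩, Finset.mem_filter.2 ⟨Finset.mem_univ _, he⟩, rfl⟩)

/-- The event is a box in the product space, so independence gives a factor `p` per required edge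
and `1 - p` per forbidden one. -/
theorem measureReal_edgeEvent {p : ℝ} (h0 : 0 ≤ p) (h1 : p ≤ 1) {T U : Finset (Sym2 (Fin n))}
    (hT : ∀ e ∈ T, e ∈ (⊤ : SimpleGraph (Fin n)).edgeSet)
    (hU : ∀ e ∈ U, e ∈ (⊤ : SimpleGraph (Fin n)).edgeSet) (hTU : Disjoint T U) :
    (uniformWeights n).real (edgeEvent T U p) = p ^ T.card * (1 - p) ^ U.card := by
  have hset : edgeEvent T U p = Set.pi Set.univ fun e =>
      if e.1 ∈ T then Set.Iic p else if e.1 ∈ U then Set.Ioi p else Set.univ := by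
    ext W
    simp only [edgeEvent, Set.mem_ofPred_eq, Set.mem_pi, Set.mem_univ, true_implies]
    constructor
    · rintro ⟨hWT, hWU⟩ e
      split_ifs with h h'
      exacts [hWT e h, hWU e h', trivial]
    · intro h
      refine ⟨fun e he => ?_, fun e he => ?_⟩
      · have := h e
        rwa [if_pos he] at this
      · have := h e
        rwa [if_neg fun h' => Finset.disjoint_left.1 hTU h' he, if_pos he] at this
  rw [hset, uniformWeights, measureReal_def, Measure.pi_pi, ENNReal.toReal_prod,
    ← prod_edgeSet_ite T hT, ← prod_edgeSet_ite U hU, ← Finset.prod_mul_distrib]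
  refine Finset.prod_congr rfl fun e _ => ?_
  by_cases he : e.1 ∈ T
  · rw [if_pos he, if_pos he, if_neg (Finset.disjoint_left.1 hTU he), uniform_Iic h1,
      ENNReal.toReal_ofReal h0, mul_one]
  · rw [if_neg he, if_neg he]
    by_cases he' : e.1 ∈ U
    · rw [if_pos he', if_pos he', uniform_Ioi h0, ENNReal.toReal_ofReal (by linarith), one_mul]
    · rw [if_neg he', if_neg he', measure_univ]
      simp

/-- An edge that is both required and forbidden makes the event empty, so as an upper bound the
product formula needs no disjointness. -/
theorem measureReal_edgeEvent_le {p : ℝ} (h0 : 0 ≤ p) (h1 : p ≤ 1) {T U : Finset (Sym2 (Fin n))}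
    (hT : ∀ e ∈ T, e ∈ (⊤ : SimpleGraph (Fin n)).edgeSet)
    (hU : ∀ e ∈ U, e ∈ (⊤ : SimpleGraph (Fin n)).edgeSet) :
    (uniformWeights n).real (edgeEvent T U p) ≤ p ^ T.card * (1 - p) ^ U.card := by
  by_cases hTU : Disjoint T U
  · exact (measureReal_edgeEvent h0 h1 hT hU hTU).le
  · obtain ⟨e, heT, heU⟩ := Finset.not_disjoint_iff.1 hTU
    have : edgeEvent T U p = ∅ := by
      refine Set.eq_empty_of_forall_notMem fun W hW => ?_
      exact absurd (hW.1 ⟨e, hT e heT⟩ heT) (not_le.2 (hW.2 ⟨e, hT e heT⟩ heU))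
    rw [this, measureReal_empty]
    have : 0 ≤ 1 - p := by linarith
    positivity

/-- The edges of the complete graph between `S` and its complement. -/
def cutEdges (S : Finset (Fin n)) : Finset (Sym2 (Fin n)) :=
  (S ×ˢ Sᶜ).image fun x => s(x.1, x.2)

theorem mk_mem_cutEdges {S : Finset (Fin n)} {x y : Fin n} :
    s(x, y) ∈ cutEdges S ↔ (x ∈ S ∧ y ∉ S) ∨ (y ∈ S ∧ x ∉ S) := by
  simp only [cutEdges, Finset.mem_image, Finset.mem_product, Finset.mem_compl, Prod.exists,
    Sym2.eq_iff]
  constructor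
  · rintro ⟨a, b, ⟨ha, hb⟩, ⟨rfl, rfl⟩ | ⟨rfl, rfl⟩⟩
    · exact Or.inl ⟨ha, hb⟩
    · exact Or.inr ⟨ha, hb⟩
  · rintro (⟨hx, hy⟩ | ⟨hy, hx⟩)
    · exact ⟨x, y, ⟨hx, hy⟩, Or.inl ⟨rfl, rfl⟩⟩
    · exact ⟨y, x, ⟨hy, hx⟩, Or.inr ⟨rfl, rfl⟩⟩

theorem cutEdges_subset_edgeSet (S : Finset (Fin n)) :
    ∀ e ∈ cutEdges S, e ∈ (⊤ : SimpleGraph (Fin n)).edgeSet := by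
  intro e
  induction e with
  | h x y =>
    rw [mk_mem_cutEdges, SimpleGraph.mem_edgeSet, SimpleGraph.top_adj]
    rintro (⟨hx, hy⟩ | ⟨hy, hx⟩) rfl <;> contradiction

theorem card_cutEdges (S : Finset (Fin n)) : (cutEdges S).card = S.card * (n - S.card) := by
  rw [cutEdges, Finset.card_image_of_injOn, Finset.card_product, Finset.card_compl,
    Fintype.card_fin]
  rintro ⟨a, b⟩ hab ⟨c, d⟩ hcd h
  simp only [Finset.coe_product, Set.mem_prod, Finset.mem_coe, Finset.mem_compl] at hab hcd
  rcases Sym2.eq_iff.1 h with h | h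
  · exact Prod.ext h.1 h.2
  · have h1 : a = d := h.1
    exact absurd (h1 ▸ hab.1) hcd.2

theorem isCutOff_iff (W : (⊤ : SimpleGraph (Fin n)).edgeSet → ℝ) (p : ℝ) (S : Finset (Fin n)) :
    IsCutOff (standardFiltration W p) S ↔ ∀ e, e.1 ∈ cutEdges S → p < W e := by
  constructor
  · rintro h ⟨e, he⟩ hc
    induction e with
    | h x y =>
      by_contra hle
      rw [not_lt] at hle
      have hadj : (standardFiltration W p).Adj x y := ⟨he, hle⟩
      rcases mk_mem_cutEdges.1 hc with ⟨hx, hy⟩ | ⟨hy, hx⟩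
      · exact h x hx y hy hadj
      · exact h y hy x hx hadj.symm
  · rintro h x hx y hy ⟨hxy, hW⟩
    exact absurd hW (not_le.2 (h ⟨s(x, y), hxy⟩ (mk_mem_cutEdges.2 (Or.inl ⟨hx, hy⟩))))

theorem measureReal_isCutOff_le {p : ℝ} (h0 : 0 ≤ p) (h1 : p ≤ 1) (S : Finset (Fin n)) :
    (uniformWeights n).real {W | IsCutOff (standardFiltration W p) S} ≤
      (1 - p) ^ (S.card * (n - S.card)) := by
  have h := measureReal_edgeEvent_le h0 h1 (T := ∅) (by simp) (cutEdges_subset_edgeSet S)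
  rw [card_cutEdges, Finset.card_empty, pow_zero, one_mul] at h
  refine le_trans (measureReal_mono fun W hW => ?_) h
  exact ⟨by simp, (isCutOff_iff W p S).1 hW⟩

theorem parentEdges_subset_edgeSet (S : Finset (Fin n)) (f : Fin n → Fin n) :
    ∀ e ∈ parentEdges S f, e ∈ (⊤ : SimpleGraph (Fin n)).edgeSet := by
  intro e he
  obtain ⟨x, hx, rfl⟩ := Finset.mem_image.1 he
  exact (Finset.mem_filter.1 hx).2.symm

/-- Union bound over parent maps: a component has a spanning tree with `|S| - 1` edges present and
all its cut edges absent. Counting all self-maps of `S` gives `|S| ^ |S|` instead of Cayley's `|S| ^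
(|S| - 2)`, which is good enough because `n.choose r * r ^ r ≤ n ^ r * e ^ r`. -/
theorem measureReal_isComponent_le {p : ℝ} (h0 : 0 ≤ p) (h1 : p ≤ 1) (S : Finset (Fin n)) :
    (uniformWeights n).real {W | IsComponent (standardFiltration W p) S} ≤
      (S.card : ℝ) ^ S.card * (p ^ (S.card - 1) * (1 - p) ^ (S.card * (n - S.card))) := by
  let F : Finset (Fin n → Fin n) := Fintype.piFinset fun x => if x ∈ S then S else {x}
  have hFcard : F.card = S.card ^ S.card := by
    have : ∀ x : Fin n, (if x ∈ S then S else {x}).card = if x ∈ S then S.card else 1 := by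
      intro x; split_ifs <;> simp
    simp only [F, Fintype.card_piFinset, this]
    rw [Finset.prod_ite, Finset.prod_const_one, mul_one, Finset.prod_const]
    congr 2
    ext; simp
  let F' := F.filter fun f => (parentEdges S f).card = S.card - 1
  have hsub : {W | IsComponent (standardFiltration W p) S} ⊆
      ⋃ f ∈ F', edgeEvent (parentEdges S f) (cutEdges S) p := by
    intro W hW
    obtain ⟨f, hfS, hf, hcard, he⟩ := hW.exists_parent
    simp only [Set.mem_iUnion]
    refine ⟨f, Finset.mem_filter.2 ⟨Fintype.mem_piFinset.2 fun x => ?_, hcard⟩, ?_,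
      (isCutOff_iff W p S).1 hW.isCutOff⟩
    · split_ifs with hx
      · exact hfS x hx
      · exact Finset.mem_singleton.2 (hf x hx)
    · rintro ⟨e, he'⟩ heT
      have := he e heT
      induction e with
      | h x y => exact this.2
  refine (measureReal_mono hsub (measure_ne_top _ _)).trans ((measureReal_biUnion_finset_le _ _).trans ?_)
  have hq : 0 ≤ 1 - p := by linarith
  calc ∑ f ∈ F', (uniformWeights n).real (edgeEvent (parentEdges S f) (cutEdges S) p)
      ≤ ∑ f ∈ F', p ^ (S.card - 1) * (1 - p) ^ (S.card * (n - S.card)) := by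
        refine Finset.sum_le_sum fun f hf => ?_
        have := measureReal_edgeEvent_le h0 h1 (parentEdges_subset_edgeSet S f)
          (cutEdges_subset_edgeSet S)
        rwa [(Finset.mem_filter.1 hf).2, card_cutEdges] at this
    _ ≤ ∑ f ∈ F, p ^ (S.card - 1) * (1 - p) ^ (S.card * (n - S.card)) :=
        Finset.sum_le_sum_of_subset_of_nonneg (Finset.filter_subset _ _)
          fun _ _ _ => by positivity
    _ = _ := by rw [Finset.sum_const, hFcard, nsmul_eq_mul]; push_cast; ring

theorem one_sub_probConnected_le {k : ℕ} {p : ℝ} (h0 : 0 ≤ p) (h1 : p ≤ 1) (hkn : 4 * k ≤ n) :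
    1 - probConnected k n p ≤
      (∑ r ∈ Finset.range (n + 1), if k ≤ r ∧ 2 * r ≤ n then
        (n.choose r : ℝ) * ((r : ℝ) ^ r * (p ^ (r - 1) * (1 - p) ^ (r * (n - r)))) else 0) +
      2 ^ n * Real.exp (-(p * n ^ 2 / 8)) := by
  classical
  set μ := uniformWeights n
  have hq : 0 ≤ 1 - p := by linarith
  let A := {W | (clusterFiltration (G := (⊤ : SimpleGraph (Fin n))) k W p).Connected}
  let C : Finset (Finset (Fin n)) := Finset.univ.filter fun S => k ≤ S.card ∧ 2 * S.card ≤ n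
  let D : Finset (Finset (Fin n)) := Finset.univ.filter fun S => n ≤ 4 * S.card ∧ 2 * S.card ≤ n
  have hsub : Aᶜ ⊆ (⋃ S ∈ C, {W | IsComponent (standardFiltration W p) S}) ∪
      ⋃ S ∈ D, {W | IsCutOff (standardFiltration W p) S} := by
    intro W hW
    simp only [Set.mem_union, Set.mem_iUnion, C, D, Finset.mem_filter, Finset.mem_univ, true_and]
    rcases exists_of_not_connected W h0 (by rwa [Fintype.card_fin]) hW with
      ⟨S, hS, h⟩ | ⟨S, hS, h⟩
    · exact Or.inl ⟨S, by simpa using h, hS⟩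
    · exact Or.inr ⟨S, by simpa using h, hS⟩
  -- Subadditivity of the outer measure suffices here, so measurability of `A` is not needed.
  have h1A : 1 ≤ μ.real A + μ.real Aᶜ := by
    have := measureReal_union_le (μ := μ) A Aᶜ
    rwa [Set.union_compl_self, probReal_univ] at this
  have hAc : μ.real Aᶜ ≤ ∑ S ∈ C, μ.real {W | IsComponent (standardFiltration W p) S} +
      ∑ S ∈ D, μ.real {W | IsCutOff (standardFiltration W p) S} :=
    (measureReal_mono hsub (measure_ne_top _ _)).trans ((measureReal_union_le _ _).trans
      (add_le_add (measureReal_biUnion_finset_le _ _) (measureReal_biUnion_finset_le _ _)))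
  have hC : ∑ S ∈ C, μ.real {W | IsComponent (standardFiltration W p) S} ≤
      ∑ r ∈ Finset.range (n + 1), if k ≤ r ∧ 2 * r ≤ n then
        (n.choose r : ℝ) * ((r : ℝ) ^ r * (p ^ (r - 1) * (1 - p) ^ (r * (n - r)))) else 0 := by
    refine (Finset.sum_le_sum fun S _ => measureReal_isComponent_le h0 h1 S).trans ?_
    rw [Finset.sum_filter]
    have h := Finset.sum_powerset_apply_card (x := (Finset.univ : Finset (Fin n))) (fun r => if k ≤ r ∧ 2 * r ≤ n then
      ((r : ℝ) ^ r * (p ^ (r - 1) * (1 - p) ^ (r * (n - r)))) else 0)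
    rw [Finset.powerset_univ, Finset.card_univ, Fintype.card_fin] at h
    rw [h]
    refine Finset.sum_le_sum fun r _ => ?_
    split_ifs <;> simp
  have hD : ∑ S ∈ D, μ.real {W | IsCutOff (standardFiltration W p) S} ≤
      2 ^ n * Real.exp (-(p * n ^ 2 / 8)) := by
    calc ∑ S ∈ D, μ.real {W | IsCutOff (standardFiltration W p) S}
        ≤ ∑ S ∈ D, Real.exp (-(p * n ^ 2 / 8)) := by
          refine Finset.sum_le_sum fun S hS => (measureReal_isCutOff_le h0 h1 S).trans ?_
          obtain ⟨-, hn4, hn2⟩ := Finset.mem_filter.1 hS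
          have hpe : 1 - p ≤ Real.exp (-p) := Real.one_sub_le_exp_neg p
          refine (pow_le_pow_left₀ hq hpe _).trans ?_
          rw [← Real.exp_nat_mul, Real.exp_le_exp]
          have h4 : (n : ℝ) ≤ 4 * S.card := by exact_mod_cast hn4
          have h2 : 2 * (S.card : ℝ) ≤ n := by exact_mod_cast hn2
          rw [Nat.cast_mul, Nat.cast_sub (by omega)]
          -- One side has at least `n/4` vertices and the other at least `n/2`.
          have : (n : ℝ) ^ 2 / 8 ≤ S.card * (n - S.card) := by
            nlinarith [mul_nonneg (sub_nonneg.2 h4) (sub_nonneg.2 h2)]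
          nlinarith
      _ ≤ ∑ S : Finset (Fin n), Real.exp (-(p * n ^ 2 / 8)) :=
          Finset.sum_le_sum_of_subset_of_nonneg (Finset.subset_univ _)
            fun _ _ _ => (Real.exp_pos _).le
      _ = _ := by simp
  have : probConnected k n p = μ.real A := rfl
  linarith

end Probability

/-! ### Chebyshev's inequality and components spanned by a star -/

section SecondMoment

/-- Second moment bound for the event that at most one of the events `A i` occurs. -/
theorem measureReal_le_of_pairwise {Ω ι : Type*} [MeasurableSpace Ω] (μ : Measure Ω)
    [IsProbabilityMeasure μ] (I : Finset ι) (A : ι → Set Ω) (hA : ∀ i, MeasurableSet (A i))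
    {q c : ℝ} (hc0 : 0 ≤ c) (hq : ∀ i ∈ I, μ.real (A i) = q)
    (hc : ∀ i ∈ I, ∀ j ∈ I, i ≠ j → μ.real (A i ∩ A j) ≤ c * q ^ 2)
    (hm : 1 < I.card * q) (B : Set Ω)
    (hB : ∀ ω ∈ B, ∀ i ∈ I, ∀ j ∈ I, ω ∈ A i → ω ∈ A j → i = j) :
    μ.real B ≤ (I.card * q + (c - 1) * (I.card * q) ^ 2) / (I.card * q - 1) ^ 2 := by
  classical
  set m : ℝ := I.card * q with hm_def
  let X : Ω → ℝ := fun ω => ∑ i ∈ I, (A i).indicator 1 ω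
  have hint : ∀ s : Set Ω, MeasurableSet s → Integrable (s.indicator (1 : Ω → ℝ)) μ :=
    fun s hs => (integrable_const (1 : ℝ)).indicator hs
  have hsq : ∀ ω, (X ω - m) ^ 2 = ∑ i ∈ I, ∑ j ∈ I, (A i ∩ A j).indicator 1 ω
      - 2 * m * ∑ i ∈ I, (A i).indicator 1 ω + m ^ 2 := by
    intro ω
    have : X ω ^ 2 = ∑ i ∈ I, ∑ j ∈ I, (A i ∩ A j).indicator 1 ω := by
      rw [sq, Finset.sum_mul_sum]
      refine Finset.sum_congr rfl fun i _ => Finset.sum_congr rfl fun j _ => ?_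
      rw [Set.inter_indicator_one, Pi.mul_apply]
    rw [← this]
    ring
  have hint1 : Integrable (fun ω => ∑ i ∈ I, (A i).indicator (1 : Ω → ℝ) ω) μ :=
    integrable_finsetSum _ fun i _ => hint _ (hA i)
  have hint2 : Integrable (fun ω => ∑ i ∈ I, ∑ j ∈ I, (A i ∩ A j).indicator (1 : Ω → ℝ) ω) μ :=
    integrable_finsetSum _ fun i _ => integrable_finsetSum _ fun j _ => hint _ ((hA i).inter (hA j))
  have hint3 : Integrable (fun ω => (X ω - m) ^ 2) μ := by
    simp only [hsq]
    exact (hint2.sub (hint1.const_mul _)).add (integrable_const _)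
  have hE1 : ∫ ω, ∑ i ∈ I, (A i).indicator (1 : Ω → ℝ) ω ∂μ = m := by
    rw [integral_finsetSum _ fun i _ => hint _ (hA i)]
    simp only [integral_indicator_one (hA _)]
    rw [Finset.sum_congr rfl hq, Finset.sum_const, nsmul_eq_mul]
  have hE2 : ∫ ω, ∑ i ∈ I, ∑ j ∈ I, (A i ∩ A j).indicator (1 : Ω → ℝ) ω ∂μ ≤ m + c * m ^ 2 := by
    rw [integral_finsetSum _ fun i _ =>
      integrable_finsetSum _ fun j _ => hint _ ((hA i).inter (hA j))]
    have : ∀ i ∈ I, ∫ ω, ∑ j ∈ I, (A i ∩ A j).indicator (1 : Ω → ℝ) ω ∂μ ≤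
        q + I.card * (c * q ^ 2) := by
      intro i hi
      rw [integral_finsetSum _ fun j _ => hint _ ((hA i).inter (hA j))]
      simp only [integral_indicator_one ((hA _).inter (hA _))]
      calc ∑ j ∈ I, μ.real (A i ∩ A j)
          -- The bound `c * q ^ 2` is also granted to the diagonal term, which makes the sum uniform
          -- in `i`.
          ≤ ∑ j ∈ I, ((if i = j then q else 0) + c * q ^ 2) := by
            refine Finset.sum_le_sum fun j hj => ?_
            by_cases hij : i = j
            · subst hij
              rw [Set.inter_self, hq i hi, if_pos rfl]
              nlinarith [mul_nonneg hc0 (sq_nonneg q)]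
            · rw [if_neg hij, zero_add]
              exact hc i hi j hj hij
        _ = q + I.card * (c * q ^ 2) := by
            rw [Finset.sum_add_distrib, Finset.sum_ite_eq, if_pos hi, Finset.sum_const,
              nsmul_eq_mul]
    refine (Finset.sum_le_sum this).trans (le_of_eq ?_)
    rw [Finset.sum_const, nsmul_eq_mul, hm_def]
    ring
  have hE : ∫ ω, (X ω - m) ^ 2 ∂μ ≤ m + (c - 1) * m ^ 2 := by
    have hsub : Integrable (fun ω => ∑ i ∈ I, ∑ j ∈ I, (A i ∩ A j).indicator (1 : Ω → ℝ) ω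
        - 2 * m * ∑ i ∈ I, (A i).indicator (1 : Ω → ℝ) ω) μ := hint2.sub (hint1.const_mul _)
    simp only [hsq]
    rw [integral_add hsub (integrable_const _), integral_sub hint2 (hint1.const_mul _),
      integral_const_mul, hE1, integral_const]
    simp only [probReal_univ, smul_eq_mul, one_mul]
    linarith
  -- On `B` the count `X` is at most `1`, which is below its mean `m`, so `X` deviates from `m` by
  -- at least `m - 1`.
  have hsub : B ⊆ {ω | (m - 1) ^ 2 ≤ (X ω - m) ^ 2} := by
    intro ω hω
    have hX : X ω ≤ 1 := by
      have h1 : X ω = (I.filter fun i => ω ∈ A i).card := by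
        simp only [X, Set.indicator_apply, Pi.one_apply, Finset.sum_boole]
      rw [h1]
      have : (I.filter fun i => ω ∈ A i).card ≤ 1 := by
        refine Finset.card_le_one.2 fun i hi j hj => ?_
        rw [Finset.mem_filter] at hi hj
        exact hB ω hω i hi.1 j hj.1 hi.2 hj.2
      exact_mod_cast this
    change (m - 1) ^ 2 ≤ (X ω - m) ^ 2
    nlinarith
  have hmarkov := mul_meas_ge_le_integral_of_nonneg (μ := μ)
    (Eventually.of_forall fun ω => sq_nonneg (X ω - m)) hint3 ((m - 1) ^ 2)
  rw [le_div_iff₀ (by nlinarith), mul_comm]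
  exact (mul_le_mul_of_nonneg_left (measureReal_mono hsub (measure_ne_top _ _))
    (sq_nonneg _)).trans (hmarkov.trans hE)

variable {n : ℕ}

/-- The edges of a star spanning `S`, centred at the least element of `S`. -/
def starEdges (S : Finset (Fin n)) : Finset (Sym2 (Fin n)) :=
  if h : S.Nonempty then (S.erase (S.min' h)).image fun x => s(S.min' h, x) else ∅

theorem exists_starEdges_eq {S : Finset (Fin n)} (h : S.Nonempty) :
    ∃ c ∈ S, starEdges S = (S.erase c).image fun x => s(c, x) :=
  ⟨S.min' h, S.min'_mem h, by rw [starEdges, dif_pos h]⟩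

theorem mem_of_mem_starEdges {S : Finset (Fin n)} {x y : Fin n} (h : s(x, y) ∈ starEdges S) :
    x ∈ S ∧ y ∈ S ∧ x ≠ y := by
  rcases S.eq_empty_or_nonempty with rfl | hS
  · simp [starEdges] at h
  · obtain ⟨c, hc, hS⟩ := exists_starEdges_eq hS
    rw [hS, Finset.mem_image] at h
    obtain ⟨z, hz, h⟩ := h
    rw [Finset.mem_erase] at hz
    rcases Sym2.eq_iff.1 h with ⟨rfl, rfl⟩ | ⟨rfl, rfl⟩
    · exact ⟨hc, hz.2, hz.1.symm⟩
    · exact ⟨hz.2, hc, hz.1⟩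

theorem starEdges_subset_edgeSet (S : Finset (Fin n)) :
    ∀ e ∈ starEdges S, e ∈ (⊤ : SimpleGraph (Fin n)).edgeSet := by
  intro e
  induction e with
  | h x y => exact fun h => (mem_of_mem_starEdges h).2.2

theorem card_starEdges (S : Finset (Fin n)) : (starEdges S).card = S.card - 1 := by
  rcases S.eq_empty_or_nonempty with rfl | hS
  · simp [starEdges]
  · obtain ⟨c, hc, hS⟩ := exists_starEdges_eq hS
    rw [hS, Finset.card_image_of_injective _ fun x y hxy => Sym2.congr_right.1 hxy,
      Finset.card_erase_of_mem hc]

theorem disjoint_starEdges_cutEdges (S : Finset (Fin n)) :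
    Disjoint (starEdges S) (cutEdges S) := by
  rw [Finset.disjoint_left]
  intro e
  induction e with
  | h x y =>
    intro h h'
    obtain ⟨hx, hy, -⟩ := mem_of_mem_starEdges h
    rcases mk_mem_cutEdges.1 h' with h' | h'
    · exact h'.2 hy
    · exact h'.2 hx

/-- The event that `S` is a component containing its star. -/
def starEvent (p : ℝ) (S : Finset (Fin n)) : Set ((⊤ : SimpleGraph (Fin n)).edgeSet → ℝ) :=
  edgeEvent (starEdges S) (cutEdges S) p

theorem measureReal_starEvent {p : ℝ} (h0 : 0 ≤ p) (h1 : p ≤ 1) (S : Finset (Fin n)) :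
    (uniformWeights n).real (starEvent p S) =
      p ^ (S.card - 1) * (1 - p) ^ (S.card * (n - S.card)) := by
  rw [starEvent, measureReal_edgeEvent h0 h1 (starEdges_subset_edgeSet S)
    (cutEdges_subset_edgeSet S) (disjoint_starEdges_cutEdges S), card_starEdges, card_cutEdges]

theorem isComponent_of_mem_starEvent {p : ℝ} {S : Finset (Fin n)} (hS : S.Nonempty)
    {W : (⊤ : SimpleGraph (Fin n)).edgeSet → ℝ} (hW : W ∈ starEvent p S) :
    IsComponent (standardFiltration W p) S := by
  have hcut := (isCutOff_iff W p S).2 hW.2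
  obtain ⟨c, hc, hstar⟩ := exists_starEdges_eq hS
  refine ⟨c, hc, fun x => ⟨fun hx => ?_, fun hr => ?_⟩⟩
  · by_cases hxc : x = c
    · rw [hxc]
    · have hmem : s(c, x) ∈ starEdges S := by
        rw [hstar]
        exact Finset.mem_image_of_mem _ (Finset.mem_erase.2 ⟨hxc, hx⟩)
      exact SimpleGraph.Adj.reachable
        ⟨starEdges_subset_edgeSet S _ hmem, hW.1 ⟨_, starEdges_subset_edgeSet S _ hmem⟩ hmem⟩
  · obtain ⟨w⟩ := hr
    clear hstar
    induction w with
    | nil => exact hc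
    | cons hab w ih =>
      refine ih (by_contra fun hb => hcut _ hc _ hb hab)

theorem IsComponent.eq_of_not_disjoint {V : Type*} {H : SimpleGraph V} {S T : Finset V}
    (hS : IsComponent H S) (hT : IsComponent H T) (h : ¬ Disjoint S T) : S = T := by
  obtain ⟨z, hzS, hzT⟩ := Finset.not_disjoint_iff.1 h
  obtain ⟨u, -, hu⟩ := hS
  obtain ⟨v, -, hv⟩ := hT
  have huv : H.Reachable u v := ((hu z).1 hzS).trans ((hv z).1 hzT).symm
  ext x
  rw [hu, hv]
  exact ⟨fun hx => huv.symm.trans hx, fun hx => huv.trans hx⟩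

/-- For disjoint `S` and `T`, an edge in both cuts joins `S` to `T`, so at most `|S| |T|` edges are
counted twice. -/
theorem le_card_cutEdges_union {S T : Finset (Fin n)} (h : Disjoint S T) :
    S.card * (n - S.card) + T.card * (n - T.card) ≤
      (cutEdges S ∪ cutEdges T).card + S.card * T.card := by
  rw [← card_cutEdges, ← card_cutEdges, ← Finset.card_union_add_card_inter]
  refine Nat.add_le_add_left ?_ _
  rw [← Finset.card_product]
  refine (Finset.card_le_card (t := (S ×ˢ T).image fun x => s(x.1, x.2)) ?_).trans
    Finset.card_image_le
  intro e
  induction e with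
  | h x y =>
    rw [Finset.mem_inter, mk_mem_cutEdges, mk_mem_cutEdges, Finset.mem_image]
    have hd := Finset.disjoint_left.1 h
    rintro ⟨⟨hx, hy⟩ | ⟨hy, hx⟩, ⟨hx', hy'⟩ | ⟨hy', hx'⟩⟩
    · exact absurd hx' (hd hx)
    · exact ⟨(x, y), Finset.mem_product.2 ⟨hx, hy'⟩, rfl⟩
    · exact ⟨(y, x), Finset.mem_product.2 ⟨hy, hx'⟩, Sym2.eq_swap⟩
    · exact absurd hy' (hd hy)

/-- Distinct components cannot meet, so intersecting sets contribute nothing. For disjoint sets the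
two events share only the at most `k ^ 2` absent edges between `S` and `T`, which is the sole
deviation from independence. -/
theorem measureReal_starEvent_inter_le {k : ℕ} {p : ℝ} (h0 : 0 ≤ p) (h1 : p < 1) (hk : 1 ≤ k)
    {S T : Finset (Fin n)} (hS : S.card = k) (hT : T.card = k) (hST : S ≠ T) :
    (uniformWeights n).real (starEvent p S ∩ starEvent p T) ≤
      ((1 - p) ^ (k ^ 2))⁻¹ * (p ^ (k - 1) * (1 - p) ^ (k * (n - k))) ^ 2 := by
  have hq : 0 < 1 - p := by linarith
  have hSne : S.Nonempty := Finset.card_pos.1 (by omega)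
  have hTne : T.Nonempty := Finset.card_pos.1 (by omega)
  by_cases hd : Disjoint S T
  · have hset : starEvent p S ∩ starEvent p T =
        edgeEvent (starEdges S ∪ starEdges T) (cutEdges S ∪ cutEdges T) p := by
      ext W
      simp only [starEvent, edgeEvent, Set.mem_inter_iff, Set.mem_ofPred_eq, Finset.mem_union,
        or_imp, forall_and]
      tauto
    have hstar : Disjoint (starEdges S) (starEdges T) := by
      rw [Finset.disjoint_left]
      intro e
      induction e with
      | h x y =>
        exact fun h h' => Finset.disjoint_left.1 hd (mem_of_mem_starEdges h).1
          (mem_of_mem_starEdges h').1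
    have hle := measureReal_edgeEvent_le (n := n) (T := starEdges S ∪ starEdges T)
      (U := cutEdges S ∪ cutEdges T) h0 h1.le
      (fun e he => (Finset.mem_union.1 he).elim (starEdges_subset_edgeSet S e)
        (starEdges_subset_edgeSet T e))
      (fun e he => (Finset.mem_union.1 he).elim (cutEdges_subset_edgeSet S e)
        (cutEdges_subset_edgeSet T e))
    rw [Finset.card_union_of_disjoint hstar, card_starEdges, card_starEdges, hS, hT] at hle
    have hcard := le_card_cutEdges_union hd
    rw [hS, hT, ← sq] at hcard
    have hpow : (1 - p) ^ (cutEdges S ∪ cutEdges T).card ≤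
        ((1 - p) ^ (k ^ 2))⁻¹ * ((1 - p) ^ (k * (n - k))) ^ 2 := by
      rw [inv_mul_eq_div, le_div_iff₀ (by positivity), ← pow_add, ← pow_mul]
      exact pow_le_pow_of_le_one hq.le (by linarith) (by omega)
    rw [hset]
    refine hle.trans ((mul_le_mul_of_nonneg_left hpow (by positivity)).trans (le_of_eq ?_))
    rw [pow_add]
    ring
  · have : starEvent p S ∩ starEvent p T = ∅ := by
      refine Set.eq_empty_of_forall_notMem fun W hW => hST ?_
      exact (isComponent_of_mem_starEvent hSne hW.1).eq_of_not_disjoint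
        (isComponent_of_mem_starEvent hTne hW.2) hd
    rw [this, measureReal_empty]
    positivity

theorem probConnected_le {k : ℕ} {p m : ℝ} (h0 : 0 ≤ p) (h1 : p < 1) (hk : 1 ≤ k)
    (hm_def : m = (n.choose k : ℝ) * (p ^ (k - 1) * (1 - p) ^ (k * (n - k)))) (hm : 1 < m) :
    probConnected k n p ≤ (m + (((1 - p) ^ (k ^ 2))⁻¹ - 1) * m ^ 2) / (m - 1) ^ 2 := by
  have hq : 0 < 1 - p := by linarith
  have hcard : (Finset.powersetCard k (Finset.univ : Finset (Fin n))).card = n.choose k := by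
    rw [Finset.card_powersetCard, Finset.card_univ, Fintype.card_fin]
  have key := measureReal_le_of_pairwise (uniformWeights n)
    (Finset.powersetCard k (Finset.univ : Finset (Fin n))) (starEvent p)
    (fun S => measurableSet_edgeEvent _ _ _) (q := p ^ (k - 1) * (1 - p) ^ (k * (n - k)))
    (c := ((1 - p) ^ (k ^ 2))⁻¹) (by positivity)
    (fun S hS => by
      rw [measureReal_starEvent h0 h1.le, (Finset.mem_powersetCard.1 hS).2])
    (fun S hS T hT hST => measureReal_starEvent_inter_le h0 h1 hk
      (Finset.mem_powersetCard.1 hS).2 (Finset.mem_powersetCard.1 hT).2 hST)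
    (by rwa [hcard, ← hm_def])
    {W | (clusterFiltration k W p).Connected}
    (fun W hW S hS T hT hWS hWT => by
      by_contra hST
      have hS' := (Finset.mem_powersetCard.1 hS).2
      have hT' := (Finset.mem_powersetCard.1 hT).2
      exact not_connected_of_two_components W h0 hST
        (isComponent_of_mem_starEvent (Finset.card_pos.1 (by omega)) hWS)
        (isComponent_of_mem_starEvent (Finset.card_pos.1 (by omega)) hWT) hS'.ge hT'.ge hW)
  rwa [hcard, ← hm_def] at key

end SecondMoment

/-! ### Explicit bounds in terms of `l = np` -/

section Asymptotics

theorem component_term_le {n r : ℕ} {p : ℝ} (h0 : 0 ≤ p) (h1 : p ≤ 1) (hr : 1 ≤ r)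
    (hrn : r ≤ n) :
    (n.choose r : ℝ) * ((r : ℝ) ^ r * (p ^ (r - 1) * (1 - p) ^ (r * (n - r)))) ≤
      n * Real.exp r * (n * p) ^ (r - 1) * Real.exp (-(r * (n * p)) + p * r ^ 2) := by
  have hq : 0 ≤ 1 - p := by linarith
  have hchoose : (n.choose r : ℝ) * (r : ℝ) ^ r ≤ n ^ r * Real.exp r := by
    calc (n.choose r : ℝ) * (r : ℝ) ^ r ≤ (n ^ r / r.factorial) * (r : ℝ) ^ r := by
          gcongr
          exact Nat.choose_le_pow_div r n
      _ = n ^ r * ((r : ℝ) ^ r / r.factorial) := by ring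
      _ ≤ n ^ r * Real.exp r := by
          gcongr
          exact Real.pow_div_factorial_le_exp _ (Nat.cast_nonneg r) r
  have hexp : (1 - p) ^ (r * (n - r)) ≤ Real.exp (-(r * (n * p)) + p * r ^ 2) := by
    refine (pow_le_pow_left₀ hq (Real.one_sub_le_exp_neg p) _).trans (le_of_eq ?_)
    rw [← Real.exp_nat_mul, Nat.cast_mul, Nat.cast_sub hrn]
    congr 1
    ring
  calc (n.choose r : ℝ) * ((r : ℝ) ^ r * (p ^ (r - 1) * (1 - p) ^ (r * (n - r))))
      = ((n.choose r : ℝ) * (r : ℝ) ^ r) * p ^ (r - 1) * (1 - p) ^ (r * (n - r)) := by ring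
    _ ≤ (n ^ r * Real.exp r) * p ^ (r - 1) * Real.exp (-(r * (n * p)) + p * r ^ 2) := by
        gcongr
    _ = _ := by
        obtain ⟨s, rfl⟩ : ∃ s, r = s + 1 := ⟨r - 1, by omega⟩
        rw [Nat.add_sub_cancel, mul_pow, pow_succ]
        ring

theorem mul_exp_neg_le_one (x : ℝ) : x * Real.exp (-x) ≤ 1 := by
  rw [Real.exp_neg, ← div_eq_mul_inv, div_le_one (Real.exp_pos x)]
  linarith [Real.add_one_le_exp x]

/-- The order of magnitude of the expected number of components of size `k`. -/
def expectedOrder (k n : ℕ) (l : ℝ) : ℝ := n * l ^ (k - 1) * Real.exp (-(k * l))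

/-- Passing from size `k` to `k + j` multiplies the main part by `(l e^(-l)) ^ j ≤ 1`. The rest
depends only on `r`, which is harmless for bounded `r`. -/
theorem component_term_le_of_small {n r k : ℕ} {p : ℝ} (h0 : 0 ≤ p) (h1 : p ≤ 1) (hk : 1 ≤ k)
    (hkr : k ≤ r) (hrn : r ≤ n) :
    (n.choose r : ℝ) * ((r : ℝ) ^ r * (p ^ (r - 1) * (1 - p) ^ (r * (n - r)))) ≤
      expectedOrder k n (n * p) * Real.exp (r + r ^ 2) := by
  refine (component_term_le h0 h1 (hk.trans hkr) hrn).trans ?_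
  obtain ⟨j, rfl⟩ := Nat.exists_eq_add_of_le hkr
  set l : ℝ := n * p
  have hl : 0 ≤ l := by positivity
  have e1 : k + j - 1 = (k - 1) + j := by omega
  have e2 : Real.exp (-(((k + j : ℕ) : ℝ) * l) + p * ((k + j : ℕ) : ℝ) ^ 2) =
      Real.exp (-(k * l)) * Real.exp (-l) ^ j * Real.exp (p * ((k + j : ℕ) : ℝ) ^ 2) := by
    rw [← Real.exp_nat_mul, ← Real.exp_add, ← Real.exp_add]
    congr 1
    push_cast
    ring
  have h3 : (l * Real.exp (-l)) ^ j ≤ 1 :=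
    pow_le_one₀ (by positivity) (mul_exp_neg_le_one l)
  have h4 : Real.exp (p * ((k + j : ℕ) : ℝ) ^ 2) ≤ Real.exp (((k + j : ℕ) : ℝ) ^ 2) :=
    Real.exp_le_exp.2 (mul_le_of_le_one_left (by positivity) h1)
  rw [e1, e2, Real.exp_add, expectedOrder]
  calc n * Real.exp ((k + j : ℕ) : ℝ) * l ^ (k - 1 + j) *
        (Real.exp (-(k * l)) * Real.exp (-l) ^ j * Real.exp (p * ((k + j : ℕ) : ℝ) ^ 2))
      = n * l ^ (k - 1) * Real.exp (-(k * l)) * (Real.exp ((k + j : ℕ) : ℝ) *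
        ((l * Real.exp (-l)) ^ j * Real.exp (p * ((k + j : ℕ) : ℝ) ^ 2))) := by
        rw [pow_add, mul_pow]; ring
    _ ≤ n * l ^ (k - 1) * Real.exp (-(k * l)) * (Real.exp ((k + j : ℕ) : ℝ) *
        (1 * Real.exp (((k + j : ℕ) : ℝ) ^ 2))) := by gcongr
    _ = _ := by rw [one_mul]

/-- Since `2r ≤ n`, the correction `p r ^ 2` is at most `r l / 2`; half of the exponent `r l`
survives and the bound is geometric in `r`. -/
theorem component_term_le_of_large {n r : ℕ} {p : ℝ} (h1 : p ≤ 1) (hl : 1 ≤ n * p) (hr : 1 ≤ r)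
    (hrn : 2 * r ≤ n) :
    (n.choose r : ℝ) * ((r : ℝ) ^ r * (p ^ (r - 1) * (1 - p) ^ (r * (n - r)))) ≤
      n * (Real.exp 1 * (n * p) * Real.exp (-(n * p / 2))) ^ r := by
  have h0 : 0 ≤ p := by
    by_contra h
    have : (n : ℝ) * p ≤ 0 := mul_nonpos_of_nonneg_of_nonpos (by positivity) (not_le.1 h).le
    linarith
  refine (component_term_le h0 h1 hr (by omega)).trans ?_
  set l : ℝ := n * p
  have hrn' : 2 * (r : ℝ) ≤ n := by exact_mod_cast hrn
  have hexp : Real.exp (-(r * l) + p * r ^ 2) ≤ Real.exp (-(l / 2)) ^ r := by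
    rw [← Real.exp_nat_mul, Real.exp_le_exp]
    have : p * r * (2 * r) ≤ p * r * n := by gcongr
    have e : p * r * n = r * l := by ring
    nlinarith
  have hpow : l ^ (r - 1) ≤ l ^ r := pow_le_pow_right₀ hl (by omega)
  have he : Real.exp r = Real.exp 1 ^ r := by rw [← Real.exp_nat_mul, mul_one]
  calc n * Real.exp r * l ^ (r - 1) * Real.exp (-(r * l) + p * r ^ 2)
      ≤ n * Real.exp r * l ^ r * Real.exp (-(l / 2)) ^ r := by gcongr
    _ = _ := by rw [he, mul_pow, mul_pow]; ring

/-- With `y = e l e^(-l/2) ≤ 1`, each size `r ≥ 8k` contributes at most `n y ^ (8k)`. The at most `n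
+ 1` such terms sum to at most `2 (n y ^ (4k)) ^ 2`, and `n y ^ (4k)` is at most `Q` times a factor
that vanishes as `l → ∞`. This is why the sizes are split at `8k`. -/
theorem one_sub_probConnected_le' {k n : ℕ} {p : ℝ} (hk : 1 ≤ k) (hn : 1 ≤ n) (hkn : 4 * k ≤ n)
    (h1 : p ≤ 1) (hl : 16 ≤ n * p)
    (hy : Real.exp 1 * (n * p) * Real.exp (-(n * p / 2)) ≤ 1) :
    1 - probConnected k n p ≤
      expectedOrder k n (n * p) * ∑ r ∈ Finset.range (8 * k), Real.exp (r + r ^ 2) +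
      2 * (expectedOrder k n (n * p) *
        (Real.exp (4 * k) * ((n * p) ^ (3 * k + 1) * Real.exp (-(n * p))))) ^ 2 +
      Real.exp (-n) := by
  have h0 : 0 ≤ p := by
    by_contra h
    have : (n : ℝ) * p ≤ 0 := mul_nonpos_of_nonneg_of_nonpos (by positivity) (not_le.1 h).le
    linarith
  refine (one_sub_probConnected_le h0 h1 hkn).trans ?_
  set l : ℝ := n * p with hl_def
  set y : ℝ := Real.exp 1 * l * Real.exp (-(l / 2)) with hy_def
  set Q := expectedOrder k n l with hQ_def
  have hQ : 0 ≤ Q := by rw [hQ_def, expectedOrder]; positivity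
  have hy0 : 0 ≤ y := by positivity
  have hn1 : (1 : ℝ) ≤ n := by exact_mod_cast hn
  refine add_le_add ?_ ?_
  · have hterm : ∀ r ∈ Finset.range (n + 1), (if k ≤ r ∧ 2 * r ≤ n then
        (n.choose r : ℝ) * ((r : ℝ) ^ r * (p ^ (r - 1) * (1 - p) ^ (r * (n - r)))) else 0) ≤
        (if r < 8 * k then Q * Real.exp (r + r ^ 2) else 0) + n * y ^ (8 * k) := by
      intro r _
      have hp1 : 0 ≤ (n : ℝ) * y ^ (8 * k) := by positivity
      have hp2 : 0 ≤ if r < 8 * k then Q * Real.exp (r + r ^ 2) else 0 := by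
        split_ifs <;> positivity
      split_ifs with hr hr8 hr8
      · have := component_term_le_of_small (n := n) h0 h1 hk hr.1 (by omega)
        linarith
      · have := component_term_le_of_large (n := n) h1 (by linarith) (hk.trans hr.1) hr.2
        rw [zero_add]
        refine this.trans ?_
        gcongr n * ?_
        exact pow_le_pow_of_le_one hy0 hy (by omega)
      · positivity
      · positivity
    refine (Finset.sum_le_sum hterm).trans ?_
    rw [Finset.sum_add_distrib]
    refine add_le_add ?_ ?_
    · rw [← Finset.sum_filter, Finset.mul_sum]
      refine Finset.sum_le_sum_of_subset_of_nonneg (fun r hr => ?_) fun _ _ _ => by positivity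
      exact Finset.mem_range.2 (Finset.mem_filter.1 hr).2
    · rw [Finset.sum_const, Finset.card_range, nsmul_eq_mul]
      have hy4 : n * y ^ (4 * k) ≤ Q * (Real.exp (4 * k) * (l ^ (3 * k + 1) * Real.exp (-l))) := by
        have e : n * y ^ (4 * k) =
            Q * (Real.exp (4 * k) * (l ^ (3 * k + 1) * Real.exp (-l) ^ k)) := by
          have e1 : Real.exp 1 ^ (4 * k) = Real.exp (4 * k) := by
            rw [← Real.exp_nat_mul]; push_cast; rw [mul_one]
          have e2 : Real.exp (-(l / 2)) ^ (4 * k) = Real.exp (-(k * l)) * Real.exp (-l) ^ k := by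
            rw [← Real.exp_nat_mul, ← Real.exp_nat_mul, ← Real.exp_add]
            congr 1
            push_cast
            ring
          have e3 : l ^ (4 * k) = l ^ (k - 1) * l ^ (3 * k + 1) := by
            rw [← pow_add]; congr 1; omega
          rw [hy_def, mul_pow, mul_pow, e1, e2, e3, hQ_def, expectedOrder]
          ring
        rw [e]
        have : Real.exp (-l) ^ k ≤ Real.exp (-l) :=
          pow_le_of_le_one (Real.exp_pos _).le (Real.exp_le_one_iff.2 (by linarith)) (by omega)
        gcongr
      have hsq : (n * y ^ (4 * k)) ^ 2 ≤
          (Q * (Real.exp (4 * k) * (l ^ (3 * k + 1) * Real.exp (-l)))) ^ 2 :=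
        pow_le_pow_left₀ (by positivity) hy4 2
      have e8 : (n * y ^ (4 * k)) ^ 2 = n * (n * y ^ (8 * k)) := by
        rw [show 8 * k = 4 * k + 4 * k by ring, pow_add]; ring
      have : ((n + 1 : ℕ) : ℝ) * (n * y ^ (8 * k)) ≤ 2 * (n * (n * y ^ (8 * k))) := by
        push_cast
        have : 0 ≤ n * y ^ (8 * k) := by positivity
        nlinarith
      linarith
  · have h2 : (2 : ℝ) ^ n ≤ Real.exp n := by
      rw [show Real.exp n = Real.exp 1 ^ n by rw [← Real.exp_nat_mul, mul_one]]
      exact pow_le_pow_left₀ (by norm_num) (by linarith [Real.add_one_le_exp (1 : ℝ)]) n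
    -- The assumption `16 ≤ np` makes the exponent `p n ^ 2 / 8` at least `2n`, which beats the `2 ^
    -- n` vertex sets.
    calc (2 : ℝ) ^ n * Real.exp (-(p * n ^ 2 / 8))
        ≤ Real.exp n * Real.exp (-(2 * n)) := by
          gcongr
          have : p * n ^ 2 = l * n := by rw [hl_def]; ring
          rw [this]
          nlinarith
      _ = Real.exp (-n) := by rw [← Real.exp_add]; congr 1; ring

/-- The two losses are constants: `n.choose k ≥ (n/2) ^ k / k!` because `2k ≤ n`, and replacing `1 -
p` by `e^(-p)` costs at most `e^(-2k)` because `n p ^ 2 ≤ 1`. -/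
theorem expectedOrder_le_star {k n : ℕ} {p : ℝ} (h0 : 0 ≤ p) (hp : p ≤ 1 / 2) (hk : 1 ≤ k)
    (hkn : 2 * k ≤ n) (hl : (n * p) ^ 2 / n ≤ 1) :
    Real.exp (-(2 * k)) / (2 ^ k * k.factorial) * expectedOrder k n (n * p) ≤
      (n.choose k : ℝ) * (p ^ (k - 1) * (1 - p) ^ (k * (n - k))) := by
  have hq : 0 < 1 - p := by linarith
  have hn0 : (0 : ℝ) < n := by exact_mod_cast (show 0 < n by omega)
  have hchoose : (n : ℝ) ^ k / (2 ^ k * k.factorial) ≤ n.choose k := by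
    refine le_trans ?_ (Nat.pow_le_choose k n)
    rw [← div_div, ← div_pow]
    gcongr
    rw [Nat.cast_sub (by omega)]
    have : 2 * (k : ℝ) ≤ n := by exact_mod_cast hkn
    push_cast
    linarith
  have hexp : Real.exp (-(k * (n * p))) * Real.exp (-(2 * k)) ≤ (1 - p) ^ (k * (n - k)) := by
    -- By `log x ≥ 1 - 1/x` this reduces to `(1 - p)(1 + p + 2p²) = 1 + p²(1 - 2p) ≥ 1`, where `p ≤
    -- 1/2` enters.
    have hlog : Real.exp (-(p + 2 * p ^ 2)) ≤ 1 - p := by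
      rw [← Real.le_log_iff_exp_le hq]
      refine le_trans ?_ (Real.one_sub_inv_le_log_of_pos hq)
      rw [le_sub_comm, inv_le_iff_one_le_mul₀ hq]
      nlinarith [mul_nonneg (sq_nonneg p) (by linarith : 0 ≤ 1 - 2 * p)]
    calc Real.exp (-(k * (n * p))) * Real.exp (-(2 * k))
        ≤ Real.exp (-(p + 2 * p ^ 2)) ^ (k * n) := by
          rw [← Real.exp_nat_mul, ← Real.exp_add, Real.exp_le_exp]
          have hle : n * p ^ 2 ≤ 1 := by
            have : (n * p) ^ 2 / n = n * p ^ 2 := by field_simp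
            linarith
          push_cast
          have := mul_le_mul_of_nonneg_left hle (Nat.cast_nonneg (α := ℝ) k)
          nlinarith
      _ ≤ (1 - p) ^ (k * n) := pow_le_pow_left₀ (Real.exp_pos _).le hlog _
      _ ≤ (1 - p) ^ (k * (n - k)) :=
          pow_le_pow_of_le_one hq.le (by linarith) (Nat.mul_le_mul_left _ (Nat.sub_le _ _))
  calc Real.exp (-(2 * k)) / (2 ^ k * k.factorial) * expectedOrder k n (n * p)
      = (n : ℝ) ^ k / (2 ^ k * k.factorial) *
        (p ^ (k - 1) * (Real.exp (-(k * (n * p))) * Real.exp (-(2 * k)))) := by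
        have : (n : ℝ) ^ k = n * n ^ (k - 1) := by
          rw [← pow_succ', Nat.sub_add_cancel hk]
        rw [expectedOrder, mul_pow, this]
        ring
    _ ≤ _ := by gcongr

theorem probConnected_le' {k n : ℕ} {p m : ℝ} (h0 : 0 ≤ p) (hp : p ≤ 1 / 2) (hk : 1 ≤ k)
    (hkn : 2 * k ≤ n) (hl : (n * p) ^ 2 / n ≤ 1)
    (hm_def : m = Real.exp (-(2 * k)) / (2 ^ k * k.factorial) * expectedOrder k n (n * p))
    (hm : 2 ≤ m) :
    probConnected k n p ≤ 4 * m⁻¹ + 4 * (((1 - p) ^ (k ^ 2))⁻¹ - 1) := by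
  have hle := expectedOrder_le_star h0 hp hk hkn hl
  rw [← hm_def] at hle
  set M := (n.choose k : ℝ) * (p ^ (k - 1) * (1 - p) ^ (k * (n - k))) with hM
  have hM2 : 2 ≤ M := hm.trans hle
  refine (probConnected_le h0 (by linarith) hk hM (by linarith)).trans ?_
  have hd : 0 ≤ ((1 - p) ^ (k ^ 2))⁻¹ - 1 := by
    rw [sub_nonneg]
    exact (one_le_inv₀ (pow_pos (by linarith) _)).2 (pow_le_one₀ (by linarith) (by linarith))
  set d := ((1 - p) ^ (k ^ 2))⁻¹ - 1
  -- For `M ≥ 2` one has `M - 1 ≥ M / 2`, so the denominator is at least `M ^ 2 / 4`.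
  have h1 : (M + d * M ^ 2) / (M - 1) ^ 2 ≤ 4 * M⁻¹ + 4 * d := by
    have e : 4 * M⁻¹ + 4 * d = (M + d * M ^ 2) / (M ^ 2 / 4) := by
      have : M ≠ 0 := by linarith
      field_simp
    rw [e]
    apply div_le_div_of_nonneg_left (by positivity) (by positivity)
    nlinarith
  have h2 : M⁻¹ ≤ m⁻¹ := inv_anti₀ (by linarith) hle
  linarith

end Asymptotics

/-! ### Limits in the critical window -/

section Limits

theorem tendsto_log_natCast : Tendsto (fun n : ℕ => Real.log (n : ℝ)) atTop atTop :=
  Real.tendsto_log_atTop.comp tendsto_natCast_atTop_atTop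

theorem isLittleO_loglog_log :
    (fun n : ℕ => Real.log (Real.log (n : ℝ))) =o[atTop] fun n : ℕ => Real.log (n : ℝ) :=
  Real.isLittleO_log_id_atTop.comp_tendsto tendsto_log_natCast

variable {k : ℕ} {u l : ℕ → ℝ}

/-- Both `log log n` and the shift `u` are `o(log n)`, so only the term `(log n) / k` matters. -/
theorem tendsto_div_log
    (hu : u =o[atTop] fun n : ℕ => Real.log (Real.log (n : ℝ)))
    (hl : ∀ᶠ n : ℕ in atTop, l n =
      (1 / (k : ℝ)) * (Real.log n + ((k : ℝ) - 1) * Real.log (Real.log n)) + u n) :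
    Tendsto (fun n : ℕ => l n / Real.log n) atTop (𝓝 (1 / k)) := by
  have h1 := isLittleO_loglog_log.tendsto_div_nhds_zero
  have h2 := (hu.trans isLittleO_loglog_log).tendsto_div_nhds_zero
  have h3 := (((h1.const_mul ((k : ℝ) - 1)).const_add 1).const_mul (1 / (k : ℝ))).add h2
  rw [mul_zero, add_zero, add_zero, mul_one] at h3
  refine h3.congr' ?_
  filter_upwards [hl, tendsto_log_natCast.eventually_gt_atTop 0] with n hn hpos
  rw [hn]
  field_simp

theorem tendsto_atTop_of_div_log (hk : 1 ≤ k)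
    (h : Tendsto (fun n : ℕ => l n / Real.log n) atTop (𝓝 (1 / k))) : Tendsto l atTop atTop := by
  have hk0 : (0 : ℝ) < 1 / k := by positivity
  refine (h.pos_mul_atTop hk0 tendsto_log_natCast).congr' ?_
  filter_upwards [tendsto_log_natCast.eventually_gt_atTop 0] with n hpos
  field_simp

theorem tendsto_sq_div (h : Tendsto (fun n : ℕ => l n / Real.log n) atTop (𝓝 (1 / k))) :
    Tendsto (fun n : ℕ => l n ^ 2 / n) atTop (𝓝 0) := by
  have h1 : Tendsto (fun n : ℕ => Real.log (n : ℝ) ^ 2 / n) atTop (𝓝 0) := by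
    have := (Real.tendsto_pow_log_div_mul_add_atTop 1 0 2 one_ne_zero).comp
      (tendsto_natCast_atTop_atTop (R := ℝ))
    simpa [Function.comp_def] using this
  have h2 := (h.pow 2).mul h1
  rw [mul_zero] at h2
  refine h2.congr' ?_
  filter_upwards [tendsto_log_natCast.eventually_gt_atTop 0] with n hpos
  field_simp

theorem tendsto_div_natCast (hl : Tendsto l atTop atTop)
    (h : Tendsto (fun n : ℕ => l n ^ 2 / n) atTop (𝓝 0)) :
    Tendsto (fun n : ℕ => l n / n) atTop (𝓝 0) := by
  refine squeeze_zero' ?_ ?_ h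
  · filter_upwards [hl.eventually_ge_atTop 0] with n hn
    positivity
  · filter_upwards [hl.eventually_ge_atTop 1] with n hn
    gcongr
    nlinarith

/-- The threshold is chosen so that `e^(-kl)` equals `n⁻¹ (log n)^(-(k-1)) e^(-ku)`, which cancels
`n` and turns `l ^ (k-1)` into a power of `l / log n`. -/
theorem expectedOrder_eq (hk : 1 ≤ k)
    (hl : ∀ᶠ n : ℕ in atTop, l n =
      (1 / (k : ℝ)) * (Real.log n + ((k : ℝ) - 1) * Real.log (Real.log n)) + u n) :
    ∀ᶠ n : ℕ in atTop, expectedOrder k n (l n) =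
      (l n / Real.log n) ^ (k - 1) * Real.exp (-(k * u n)) := by
  filter_upwards [hl, tendsto_log_natCast.eventually_gt_atTop 0, eventually_gt_atTop 0]
    with n hn hpos hn0
  have hk0 : (k : ℝ) ≠ 0 := by positivity
  have hn0' : (0 : ℝ) < n := by exact_mod_cast hn0
  have hexp : Real.exp (-(k * l n)) =
      (n : ℝ)⁻¹ * (Real.log n ^ (k - 1))⁻¹ * Real.exp (-(k * u n)) := by
    have e : -(k * l n) =
        -Real.log n + -(((k - 1 : ℕ) : ℝ) * Real.log (Real.log n)) + -(k * u n) := by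
      rw [hn, Nat.cast_sub hk, Nat.cast_one]
      field_simp
      ring
    rw [e, Real.exp_add, Real.exp_add, Real.exp_neg, Real.exp_log hn0', Real.exp_neg,
      Real.exp_nat_mul, Real.exp_log hpos]
  rw [expectedOrder, hexp, div_pow]
  field_simp

end Limits

end KCluster

end

/-! ### The two sides of the threshold -/

theorem mainTheorem1 (k : ℕ) (hk : 1 ≤ k) (w : ℕ → ℝ)
    (hw : Tendsto w atTop atTop)
    (hwo : w =o[atTop] fun n : ℕ => Real.log (Real.log (n : ℝ))) :
    (∀ p : ℕ → ℝ,
      (∀ᶠ n : ℕ in atTop, (n : ℝ) * p n =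
        (1 / (k : ℝ)) * (Real.log n + ((k : ℝ) - 1) * Real.log (Real.log n)) + w n) →
      Tendsto (fun n : ℕ => KCluster.probConnected k n (p n)) atTop (𝓝 1)) ∧
    (∀ p : ℕ → ℝ,
      (∀ᶠ n : ℕ in atTop, (n : ℝ) * p n =
        (1 / (k : ℝ)) * (Real.log n + ((k : ℝ) - 1) * Real.log (Real.log n)) - w n) →
      Tendsto (fun n : ℕ => KCluster.probConnected k n (p n)) atTop (𝓝 0)) := by
  open KCluster in
  have hk0 : (0 : ℝ) < k := by exact_mod_cast hk
  have hp_of : ∀ p : ℕ → ℝ, Tendsto (fun n : ℕ => (n : ℝ) * p n / n) atTop (𝓝 0) →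
      Tendsto p atTop (𝓝 0) := by
    intro p h
    refine h.congr' ?_
    filter_upwards [eventually_gt_atTop 0] with n hn
    have : (n : ℝ) ≠ 0 := by positivity
    field_simp
  constructor
  · intro p hp
    have hdiv := tendsto_div_log hwo hp
    have hl := tendsto_atTop_of_div_log hk hdiv
    have hp0 := hp_of p (tendsto_div_natCast hl (tendsto_sq_div hdiv))
    have hQ : Tendsto (fun n : ℕ => expectedOrder k n (n * p n)) atTop (𝓝 0) := by
      have h1 : Tendsto (fun n => Real.exp (-(k * w n))) atTop (𝓝 0) :=
        Real.tendsto_exp_neg_atTop_nhds_zero.comp (hw.const_mul_atTop hk0)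
      have h2 := (hdiv.pow (k - 1)).mul h1
      rw [mul_zero] at h2
      exact h2.congr' ((expectedOrder_eq hk hp).mono fun n hn => hn.symm)
    -- This is `2e · x e^(-x)` at `x = np/2 → ∞`.
    have hy : Tendsto (fun n : ℕ => Real.exp 1 * (n * p n) * Real.exp (-(n * p n / 2)))
        atTop (𝓝 0) := by
      have h1 := ((Real.tendsto_pow_mul_exp_neg_atTop_nhds_zero 1).comp
        (hl.atTop_div_const two_pos)).const_mul (2 * Real.exp 1)
      rw [mul_zero] at h1
      refine h1.congr fun n => ?_
      simp only [Function.comp_apply, pow_one]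
      ring
    have hE : Tendsto (fun n : ℕ => (n * p n) ^ (3 * k + 1) * Real.exp (-(n * p n)))
        atTop (𝓝 0) :=
      (Real.tendsto_pow_mul_exp_neg_atTop_nhds_zero (3 * k + 1)).comp hl
    have hB : Tendsto (fun n : ℕ => expectedOrder k n (n * p n) *
          ∑ r ∈ Finset.range (8 * k), Real.exp (r + r ^ 2) +
        2 * (expectedOrder k n (n * p n) * (Real.exp (4 * k) *
          ((n * p n) ^ (3 * k + 1) * Real.exp (-(n * p n))))) ^ 2 + Real.exp (-(n : ℝ)))
        atTop (𝓝 0) := by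
      have h3 := ((hQ.mul_const (∑ r ∈ Finset.range (8 * k), Real.exp ((r : ℝ) + (r : ℝ) ^ 2))).add
        (((hQ.mul (hE.const_mul (Real.exp (4 * k)))).pow 2).const_mul 2)).add
        (Real.tendsto_exp_neg_atTop_nhds_zero.comp (tendsto_natCast_atTop_atTop (R := ℝ)))
      simpa [Function.comp_def] using h3
    have hlow := hB.const_sub 1
    rw [sub_zero] at hlow
    refine tendsto_of_tendsto_of_tendsto_of_le_of_le' hlow tendsto_const_nhds ?_ ?_
    · filter_upwards [hl.eventually_ge_atTop 16, hp0.eventually_le_const one_pos,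
        hy.eventually_le_const one_pos, eventually_ge_atTop (4 * k)] with n h16 hp1 hy1 hkn
      have := one_sub_probConnected_le' hk (by omega) hkn hp1 h16 hy1
      linarith
    · exact Eventually.of_forall fun n => measureReal_le_one
  · intro p hp
    have hp' : ∀ᶠ n : ℕ in atTop, (n : ℝ) * p n =
        (1 / (k : ℝ)) * (Real.log n + ((k : ℝ) - 1) * Real.log (Real.log n)) + -w n :=
      hp.mono fun n hn => by rw [hn, sub_eq_add_neg]
    have hdiv := tendsto_div_log hwo.neg_left hp'
    have hl := tendsto_atTop_of_div_log hk hdiv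
    have hsq := tendsto_sq_div hdiv
    have hp0 := hp_of p (tendsto_div_natCast hl hsq)
    have hQ : Tendsto (fun n : ℕ => expectedOrder k n (n * p n)) atTop atTop := by
      have h1 : Tendsto (fun n => Real.exp (-(k * -w n))) atTop atTop := by
        simp only [mul_neg, neg_neg]
        exact Real.tendsto_exp_atTop.comp (hw.const_mul_atTop hk0)
      have h2 := (hdiv.pow (k - 1)).pos_mul_atTop (by positivity) h1
      exact h2.congr' ((expectedOrder_eq hk hp').mono fun n hn => hn.symm)
    have hm := hQ.const_mul_atTop (r := Real.exp (-(2 * k)) / (2 ^ k * k.factorial))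
      (by positivity)
    have hB : Tendsto (fun n : ℕ =>
        4 * (Real.exp (-(2 * k)) / (2 ^ k * k.factorial) * expectedOrder k n (n * p n))⁻¹ +
        4 * (((1 - p n) ^ (k ^ 2))⁻¹ - 1)) atTop (𝓝 0) := by
      have h3 := (((hp0.const_sub 1).pow (k ^ 2)).inv₀ (by simp)).sub_const 1
      have h4 := (hm.inv_tendsto_atTop.const_mul 4).add (h3.const_mul 4)
      simpa using h4
    refine squeeze_zero' (Eventually.of_forall fun n => measureReal_nonneg) ?_ hB
    filter_upwards [hl.eventually_ge_atTop 0, hp0.eventually_le_const (show (0 : ℝ) < 1 / 2 by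
      norm_num), hsq.eventually_le_const one_pos, hm.eventually_ge_atTop 2,
      eventually_ge_atTop (2 * k), eventually_gt_atTop 0] with n hl0 hp1 hsq1 hm2 hkn hn
    have hn0 : (0 : ℝ) < n := by exact_mod_cast hn
    exact probConnected_le' (nonneg_of_mul_nonneg_right hl0 hn0) hp1 hk hkn hsq1 rfl hm2
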